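/- Let $G=(V,E)$ be a finite simple graph. Its edge polytope $\mathcal P_G\subset\mathbb R^V$ is the convex hull of the points $\mathbf e_u+\mathbf e_v$ with $uv\in E$, and its Ehrhart series is the formal power series $H_G(t)=\sum_{m\ge 0} i_G(m)\,t^m$, where $i_G(0)=1$ and $i_G(m)=|m\mathcal P_G\cap\mathbb Z^V|$ for $m\ge 1$. Polygon trees are defined recursively: a cycle graph (polygon) of length at least $3$ is a polygon tree, and if $G'$ is a polygon tree and $C$ is a cycle graph whose intersection with $G'$ consists of exactly one edge and its two end vertices, then $G'\cup C$ is a polygon tree. A polygon tree is bipartite if all the cycles used in its construction have even length. Proposition 4.2. Let $G$ be a bipartite polygon tree with $e$ edges, constructed from $f_{2n}$ cycles of length $2n$ for each $n\ge 2$, and put $f=\sum_{n\ge 2} f_{2n}$. Then $f\le e$ and $$H_G(t)=\frac{\prod_{n\ge 2}\left(1+t+\cdots+t^{n-1}\right)^{f_{2n}}}{(1-t)^{e-f}}.$$ -/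

import Mathlib

/-- The edge polytope of a simple graph `G` on `V`: the convex hull in `ℝ^V` of the points
`e_u + e_v`, one for each edge `uv` of `G`. -/
def edgePolytope {V : Type*} [DecidableEq V] (G : SimpleGraph V) : Set (V → ℝ) :=
  convexHull ℝ {x | ∃ u v : V, G.Adj u v ∧ x = Pi.single u 1 + Pi.single v 1}

/-- The integral points of the `m`-th dilate of the edge polytope. -/
def dilateLatticePoints {V : Type*} [DecidableEq V] (G : SimpleGraph V) (m : ℕ) :
    Set (V → ℤ) :=
  {z | ∃ x ∈ edgePolytope G, ∀ v, (z v : ℝ) = (m : ℝ) * x v}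

/-- There are finitely many such points, so that `Set.ncard` below really counts them. -/
theorem dilateLatticePoints_finite {V : Type*} [Fintype V] [DecidableEq V]
    (G : SimpleGraph V) (m : ℕ) : (dilateLatticePoints G m).Finite := by
  have hsub : edgePolytope G ⊆ Set.Icc (0 : V → ℝ) 2 := by
    refine convexHull_min ?_ (convex_Icc _ _)
    rintro x ⟨u, v, -, rfl⟩
    constructor <;> intro w <;> simp only [Pi.add_apply, Pi.single_apply,
      Pi.ofNat_apply] <;> split_ifs <;> norm_num
  refine (Set.finite_Icc (0 : V → ℤ) (fun _ => 2 * (m : ℤ))).subset ?_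
  rintro z ⟨x, hx, hz⟩
  obtain ⟨h0, h2⟩ := hsub hx
  have hm : (0 : ℝ) ≤ m := Nat.cast_nonneg m
  constructor <;> intro w
  · have h : (0 : ℝ) ≤ z w := by rw [hz w]; exact mul_nonneg hm (h0 w)
    exact_mod_cast h
  · have h : (z w : ℝ) ≤ 2 * (m : ℝ) := by
      rw [hz w, mul_comm]; exact mul_le_mul_of_nonneg_right (h2 w) hm
    exact_mod_cast h

/-- The Ehrhart counting function of the edge polytope of `G`, with value `1` at `0`. -/
noncomputable def ehrhartCount {V : Type*} [DecidableEq V] (G : SimpleGraph V) (m : ℕ) : ℕ :=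
  if m = 0 then 1 else (dilateLatticePoints G m).ncard

/-- The Ehrhart series of the edge polytope of `G`, as a formal power series. -/
noncomputable def ehrhartSeries {V : Type*} [DecidableEq V] (G : SimpleGraph V) :
    PowerSeries ℚ :=
  PowerSeries.mk fun m => (ehrhartCount G m : ℚ)

/-- The subgraph `C` is a polygon (a cycle graph) with `k` edges. -/
def IsPolygon {V : Type*} {G : SimpleGraph V} (C : G.Subgraph) (k : ℕ) : Prop :=
  3 ≤ k ∧ Nonempty (C.coe ≃g SimpleGraph.cycleGraph k)

/-- `IsPolygonTree H s`: the graph `H` (a subgraph of some graph `G`) is a polygon tree that can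
be built from polygons whose lengths form the multiset `s`.  One starts with a polygon; a step
adds a polygon which has exactly one edge, and no vertex except the two ends of that edge, in
common with the polygon tree built so far. -/
inductive IsPolygonTree {V : Type*} {G : SimpleGraph V} : G.Subgraph → Multiset ℕ → Prop
  | polygon {C : G.Subgraph} {k : ℕ} (hC : IsPolygon C k) : IsPolygonTree C {k}
  | glue {H C : G.Subgraph} {s : Multiset ℕ} {k : ℕ} {u v : V} (hH : IsPolygonTree H s)
      (hC : IsPolygon C k) (huv : G.Adj u v) (hHC : H ⊓ C = G.subgraphOfAdj huv) :
      IsPolygonTree (H ⊔ C) (k ::ₘ s)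

/-- `G` is a bipartite polygon tree built from polygons all of which have even length, exactly
`f n` of them being of length `2 n`, for each `n`. -/
def IsBipartitePolygonTree {V : Type*} (G : SimpleGraph V) (f : ℕ →₀ ℕ) : Prop :=
  ∃ s : Multiset ℕ, IsPolygonTree (⊤ : G.Subgraph) s ∧ (∀ k ∈ s, Even k) ∧
    ∀ n, f n = s.count (2 * n)

/-! The edge polytope lies in the hyperplane where the coordinates sum to 2, so $H_G$ counts the
lattice points of the cone over it, graded by half the coordinate sum
(`ehrhartSeries_eq_degreeSeries`). The cone of a single edge gives $1/(1-t)$.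

Gluing a cycle of length $2n$ attaches a path with $2n-1=2r+1$ edges whose ends are already
adjacent. This path has odd length, so the alternating sum of its edge vectors is the vector of the
edge joining its ends. Hence the least weight on the even-indexed edges (counting from 0) can be
moved onto that edge of the old graph. What remains on the path is a reduced weighting, one that
vanishes on some even-indexed edge. Inner vertices are invisible to the old cone, which makes the
remainder integral and unique. So lattice points of the new cone correspond to pairs (old lattice
point, reduced weighting), and series multiply (`IsEar.degreeSeries_eq`).

An arbitrary weighting of the path is a reduced one plus a constant on the $r+1$ even-indexed edges.
Thus $(1-t)^{-(2r+1)}=R(t)/(1-t^{r+1})$, and the factor contributed by the cycle is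
$R(t)=(1+\cdots+t^{n-1})/(1-t)^{2n-2}$ (`degreeSeries_reducedPath`). Each cycle adds $2n-1$ edges
and one polygon, so $e-f$ grows by $2n-2$, matching the exponent. -/

/-! ### Generating functions of graded sets. -/

/-- The generating function of a set graded by `deg`. -/
noncomputable def degreeSeries {α : Type*} (deg : α → ℕ) : PowerSeries ℚ :=
  PowerSeries.mk fun m => (Nat.card {x // deg x = m} : ℚ)

theorem degreeSeries_eq_of_bijective {α β : Type*} {d : α → ℕ} {d' : β → ℕ} (g : α → β)
    (hg : Function.Bijective g) (hd : ∀ x, d' (g x) = d x) : degreeSeries d = degreeSeries d' := by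
  ext m
  simp only [degreeSeries, PowerSeries.coeff_mk]
  congr 1
  exact Nat.card_congr ((Equiv.ofBijective g hg).subtypeEquiv fun x => by
    simp [hd])

theorem degreeSeries_prod {α β : Type*} {d : α → ℕ} {d' : β → ℕ}
    (hd : ∀ m, Finite {x // d x = m}) (hd' : ∀ m, Finite {x // d' x = m}) :
    degreeSeries (fun x : α × β => d x.1 + d' x.2) = degreeSeries d * degreeSeries d' := by
  ext m
  rw [PowerSeries.coeff_mul]
  simp only [degreeSeries, PowerSeries.coeff_mk]
  let e : {x : α × β // d x.1 + d' x.2 = m} ≃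
      Σ q : Finset.HasAntidiagonal.antidiagonal m, {x // d x = q.1.1} × {x // d' x = q.1.2} :=
    { toFun := fun x => ⟨⟨(d x.1.1, d' x.1.2), by simpa using x.2⟩, ⟨x.1.1, rfl⟩, ⟨x.1.2, rfl⟩⟩
      invFun := fun y => ⟨(y.2.1.1, y.2.2.1), by
        have := y.1.2
        rw [Finset.HasAntidiagonal.mem_antidiagonal] at this
        rw [y.2.1.2, y.2.2.2, this]⟩
      left_inv := fun x => rfl
      right_inv := by
        rintro ⟨⟨⟨i, j⟩, h⟩, ⟨x, hx⟩, ⟨y, hy⟩⟩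
        dsimp only at hx hy
        subst hx hy
        rfl }
  rw [Nat.card_congr e, Nat.card_sigma]
  simp only [Nat.card_prod]
  push_cast
  rw [← Finset.sum_coe_sort (Finset.HasAntidiagonal.antidiagonal m)]

theorem degreeSeries_mul_nat {c : ℕ} (hc : 0 < c) :
    degreeSeries (fun x : ℕ => c * x) * (1 - PowerSeries.X ^ c) = 1 := by
  have key : ∀ m, (PowerSeries.coeff m (degreeSeries fun x : ℕ => c * x)) =
      if c ∣ m then 1 else 0 := by
    intro m
    simp only [degreeSeries, PowerSeries.coeff_mk]
    split_ifs with h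
    · obtain ⟨k, rfl⟩ := h
      have : Unique {x // c * x = c * k} :=
        { default := ⟨k, rfl⟩
          uniq := fun y => Subtype.ext (Nat.eq_of_mul_eq_mul_left hc y.2) }
      rw [Nat.card_unique, Nat.cast_one]
    · have : IsEmpty {x // c * x = m} := ⟨fun y => h ⟨y.1, y.2.symm⟩⟩
      simp
  ext m
  rw [mul_sub, mul_one, map_sub, PowerSeries.coeff_mul_X_pow', key, PowerSeries.coeff_one]
  by_cases hm : c ≤ m
  · have : m ≠ 0 := by omega
    rw [if_pos hm, key, if_neg this]
    simp only [Nat.dvd_sub_iff_left hm dvd_rfl, sub_self]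
  · rw [if_neg hm]
    rcases Nat.eq_zero_or_pos m with rfl | h
    · simp
    · rw [if_neg (fun h' => hm (Nat.le_of_dvd h h')), if_neg h.ne']
      simp

theorem degreeSeries_id : degreeSeries (fun x : ℕ => x) * (1 - PowerSeries.X) = 1 := by
  simpa using degreeSeries_mul_nat one_pos

theorem finite_sum_eq {ι : Type*} [Fintype ι] (m : ℕ) :
    Finite {p : ι → ℕ // ∑ i, p i = m} := by
  classical
  refine ((Set.finite_Icc (0 : ι → ℕ) fun _ => m).subset ?_).to_subtype
  rintro p rfl
  exact ⟨fun i => Nat.zero_le _, fun i => Finset.single_le_sum (fun _ _ => Nat.zero_le _)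
    (Finset.mem_univ i)⟩

theorem degreeSeries_pi_fin (k : ℕ) :
    degreeSeries (fun p : Fin k → ℕ => ∑ i, p i) * (1 - PowerSeries.X) ^ k = 1 := by
  induction k with
  | zero =>
    have : degreeSeries (fun p : Fin 0 → ℕ => ∑ i, p i) = 1 := by
      ext m
      simp only [degreeSeries, PowerSeries.coeff_mk, PowerSeries.coeff_one, Finset.univ_eq_empty,
        Finset.sum_empty]
      split_ifs with h
      · subst h; simp
      · have : IsEmpty {_x : Fin 0 → ℕ // 0 = m} := ⟨fun y => h y.2.symm⟩
        simp
    rw [this, pow_zero, one_mul]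
  | succ k ih =>
    have h : degreeSeries (fun p : Fin (k + 1) → ℕ => ∑ i, p i) =
        degreeSeries (fun x : ℕ => x) * degreeSeries (fun p : Fin k → ℕ => ∑ i, p i) := by
      rw [← degreeSeries_prod (fun m => inferInstance) finite_sum_eq]
      refine degreeSeries_eq_of_bijective (fun p => (p 0, Fin.tail p)) ?_ ?_
      · exact (Fin.consEquiv fun _ : Fin (k + 1) => ℕ).symm.bijective
      · intro p
        simp [Fin.sum_univ_succ, Fin.tail]
    calc _ = (degreeSeries (fun x : ℕ => x) * (1 - PowerSeries.X)) *
          (degreeSeries (fun p : Fin k → ℕ => ∑ i, p i) * (1 - PowerSeries.X) ^ k) := by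
            rw [h]; ring
      _ = 1 := by rw [ih, degreeSeries_id, one_mul]

/-! ### Reduced weightings of an odd path. -/

/-- Weightings of a path with `2 r + 1` edges that vanish on some edge of even index. -/
def ReducedPath (r : ℕ) : Type :=
  {p : Fin (2 * r + 1) → ℕ // ∃ i : Fin (2 * r + 1), Even i.val ∧ p i = 0}

def ReducedPath.deg {r : ℕ} (p : ReducedPath r) : ℕ := ∑ i, p.1 i

theorem ReducedPath.finite_deg_eq (r m : ℕ) : Finite {p : ReducedPath r // p.deg = m} := by
  have := finite_sum_eq (ι := Fin (2 * r + 1)) m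
  refine Finite.of_injective
    (fun p => (⟨p.1.1, p.2⟩ : {p : Fin (2 * r + 1) → ℕ // ∑ i, p i = m})) ?_
  intro p q h
  have hval := congrArg Subtype.val h
  exact Subtype.ext (Subtype.ext hval)

theorem sum_ite_even_fin {M : Type*} [AddCommMonoid M] (r : ℕ) (c : M) :
    ∑ i : Fin (2 * r + 1), (if Even i.val then c else 0) = (r + 1) • c := by
  rw [Fin.sum_univ_eq_sum_range (fun i => if Even i then c else 0)]
  induction r with
  | zero => simp
  | succ r ih =>
    rw [show 2 * (r + 1) + 1 = 2 * r + 1 + 1 + 1 by ring, Finset.sum_range_succ,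
      Finset.sum_range_succ, ih, if_neg (by grind), if_pos (by grind), add_zero, ← succ_nsmul]

theorem ReducedPath.bijective_shift (r : ℕ) :
    Function.Bijective (fun (x : ReducedPath r × ℕ) (i : Fin (2 * r + 1)) =>
      x.1.1 i + if Even i.val then x.2 else 0) := by
  constructor
  · rintro ⟨⟨p, i, hi, hpi⟩, c⟩ ⟨⟨q, j, hj, hqj⟩, d⟩ h
    -- Comparing at a zero of `p` gives `d ≤ c`, at a zero of `q` gives `c ≤ d`.
    have h1 := congrFun h i
    have h2 := congrFun h j
    simp only [hi, hj, hpi, hqj, if_true] at h1 h2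
    have hcd : c = d := by omega
    subst hcd
    refine Prod.ext (Subtype.ext (funext fun l => ?_)) rfl
    exact Nat.add_right_cancel (congrFun h l)
  · intro w
    obtain ⟨i, hi, hmin⟩ := Finset.exists_min_image
      (Finset.univ.filter fun i : Fin (2 * r + 1) => Even i.val) w ⟨0, by simp⟩
    simp only [Finset.mem_filter, Finset.mem_univ, true_and] at hi hmin
    refine ⟨⟨⟨fun l => w l - if Even l.val then w i else 0, i, hi, by simp [hi]⟩, w i⟩, ?_⟩
    funext l
    by_cases hl : Even l.val
    · simpa [hl] using Nat.sub_add_cancel (hmin l hl)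
    · simp [hl]

/-- All weightings are counted twice: freely, and as a reduced weighting plus a shift. A unit shift
has degree `r + 1`, the number of even-indexed edges. -/
theorem degreeSeries_reducedPath (r : ℕ) :
    degreeSeries (ReducedPath.deg (r := r)) * (1 - PowerSeries.X) ^ (2 * r) =
      ∑ i ∈ Finset.range (r + 1), (PowerSeries.X : PowerSeries ℚ) ^ i := by
  have h : degreeSeries (fun p : Fin (2 * r + 1) → ℕ => ∑ i, p i) =
      degreeSeries (ReducedPath.deg (r := r)) * degreeSeries (fun x : ℕ => (r + 1) * x) := by
    rw [← degreeSeries_prod (ReducedPath.finite_deg_eq r)]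
    · refine (degreeSeries_eq_of_bijective _ (ReducedPath.bijective_shift r) ?_).symm
      rintro ⟨p, c⟩
      simp only [Finset.sum_add_distrib, sum_ite_even_fin, ReducedPath.deg, smul_eq_mul]
    · intro m
      refine Finite.of_injective (fun x => (⟨x.1, ?_⟩ : Set.Iic m)) ?_
      · exact Nat.le_trans (Nat.le_mul_of_pos_left _ r.succ_pos) x.2.le
      · intro x y hxy
        simpa [Subtype.ext_iff] using hxy
  have h1 := degreeSeries_pi_fin (2 * r + 1)
  have h2 := degreeSeries_mul_nat r.succ_pos
  have h3 : (∑ i ∈ Finset.range (r + 1), (PowerSeries.X : PowerSeries ℚ) ^ i) *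
      (1 - PowerSeries.X) = 1 - PowerSeries.X ^ (r + 1) := geom_sum_mul_neg _ _
  have hne : (1 - PowerSeries.X : PowerSeries ℚ) ≠ 0 := by
    intro h0
    simpa using congrArg PowerSeries.constantCoeff h0
  refine mul_right_cancel₀ hne ?_
  rw [h3]
  rw [h] at h1
  calc _ = degreeSeries (ReducedPath.deg (r := r)) * (1 - PowerSeries.X) ^ (2 * r + 1) *
        (degreeSeries (fun x : ℕ => (r + 1) * x) * (1 - PowerSeries.X ^ (r + 1))) := by
          rw [h2]; ring
    _ = (degreeSeries (ReducedPath.deg (r := r)) * degreeSeries (fun x : ℕ => (r + 1) * x) *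
        (1 - PowerSeries.X) ^ (2 * r + 1)) * (1 - PowerSeries.X ^ (r + 1)) := by ring
    _ = _ := by rw [h1, one_mul]

/-! ### The edge cone and the Ehrhart series. -/

open scoped NNReal

/-- The points `e_u + e_v`, one for each edge `uv` of the subgraph `H`. -/
def edgeVectors {V : Type*} [DecidableEq V] {G : SimpleGraph V} (H : G.Subgraph) :
    Set (V → ℝ) :=
  {x | ∃ u v : V, H.Adj u v ∧ x = Pi.single u 1 + Pi.single v 1}

/-- The cone generated by the points `e_u + e_v`, for `uv` an edge of the subgraph `H`. -/
noncomputable def edgeCone {V : Type*} [DecidableEq V] {G : SimpleGraph V} (H : G.Subgraph) :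
    Submodule ℝ≥0 (V → ℝ) :=
  Submodule.span ℝ≥0 (edgeVectors H)

/-- The integral points `z` of the edge cone, graded by half the sum of their coordinates. -/
def LatticeCone {V : Type*} [Fintype V] [DecidableEq V] {G : SimpleGraph V} (H : G.Subgraph) :
    Type _ :=
  {q : (V → ℤ) × ℕ // (fun v => (q.1 v : ℝ)) ∈ edgeCone H ∧ ∑ v, q.1 v = 2 * (q.2 : ℤ)}

def LatticeCone.deg {V : Type*} [Fintype V] [DecidableEq V] {G : SimpleGraph V}
    {H : G.Subgraph} (q : LatticeCone H) : ℕ := q.1.2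

section

variable {V : Type*} [DecidableEq V] {G : SimpleGraph V} {H : G.Subgraph}

theorem edgeCone_nonneg {x : V → ℝ} (hx : x ∈ edgeCone H) (v : V) : 0 ≤ x v := by
  induction hx using Submodule.span_induction with
  | mem x h =>
    obtain ⟨a, b, -, rfl⟩ := h
    simp only [Pi.add_apply, Pi.single_apply]
    split_ifs <;> norm_num
  | zero => simp
  | add x y _ _ hx hy => exact add_nonneg hx hy
  | smul c x _ hx => exact mul_nonneg c.2 hx

theorem edgeCone_eq_zero {x : V → ℝ} (hx : x ∈ edgeCone H) {v : V} (hv : v ∉ H.verts) :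
    x v = 0 := by
  induction hx using Submodule.span_induction with
  | mem x h =>
    obtain ⟨a, b, hab, rfl⟩ := h
    have ha : v ≠ a := fun h => hv (h ▸ hab.fst_mem)
    have hb : v ≠ b := fun h => hv (h ▸ hab.snd_mem)
    simp [ha, hb]
  | zero => simp
  | add x y _ _ hx hy => simp [hx, hy]
  | smul c x _ hx => simp [hx]

theorem smul_mem_edgeCone {x : V → ℝ} (hx : x ∈ edgeCone H) {c : ℝ} (hc : 0 ≤ c) :
    c • x ∈ edgeCone H :=
  (edgeCone H).smul_mem ⟨c, hc⟩ hx

theorem edgePolytope_subset [Fintype V] (G : SimpleGraph V) {x : V → ℝ} (hx : x ∈ edgePolytope G) :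
    x ∈ edgeCone (⊤ : G.Subgraph) ∧ ∑ v, x v = 2 := by
  have hconv : Convex ℝ {x : V → ℝ | x ∈ edgeCone (⊤ : G.Subgraph) ∧ ∑ v, x v = 2} := by
    rintro x ⟨hx, hx2⟩ y ⟨hy, hy2⟩ a b ha hb hab
    refine ⟨add_mem (smul_mem_edgeCone hx ha) (smul_mem_edgeCone hy hb), ?_⟩
    simp only [Pi.add_apply, Pi.smul_apply, smul_eq_mul, Finset.sum_add_distrib,
      ← Finset.mul_sum, hx2, hy2]
    linarith
  refine convexHull_min ?_ hconv hx
  rintro x ⟨u, v, huv, rfl⟩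
  refine ⟨Submodule.subset_span ⟨u, v, by simpa using huv, rfl⟩, ?_⟩
  simp only [Pi.add_apply, Finset.sum_add_distrib, Finset.sum_pi_single', Finset.mem_univ,
    if_true]
  norm_num

theorem exists_smul_of_mem_edgeCone_top {G : SimpleGraph V} (hne : (edgePolytope G).Nonempty)
    {y : V → ℝ} (hy : y ∈ edgeCone (⊤ : G.Subgraph)) :
    ∃ c : ℝ, 0 ≤ c ∧ ∃ x ∈ edgePolytope G, y = c • x := by
  induction hy using Submodule.span_induction with
  | mem x h =>
    obtain ⟨u, v, huv, rfl⟩ := h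
    exact ⟨1, zero_le_one, _, subset_convexHull ℝ _ ⟨u, v, by simpa using huv, rfl⟩,
      (one_smul _ _).symm⟩
  | zero => exact ⟨0, le_rfl, _, hne.some_mem, (zero_smul _ _).symm⟩
  | add x y _ _ hx hy =>
    obtain ⟨a, ha, x, hx, rfl⟩ := hx
    obtain ⟨b, hb, y, hy, rfl⟩ := hy
    rcases (add_nonneg ha hb).eq_or_lt with h | h
    · have ha0 : a = 0 := by linarith
      have hb0 : b = 0 := by linarith
      exact ⟨0, le_rfl, x, hx, by simp [ha0, hb0]⟩
    · refine ⟨a + b, h.le, (a / (a + b)) • x + (b / (a + b)) • y,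
        convex_convexHull ℝ _ hx hy (by positivity) (by positivity) (by field_simp), ?_⟩
      rw [smul_add, smul_smul, smul_smul, mul_div_cancel₀ _ h.ne', mul_div_cancel₀ _ h.ne']
  | smul c x _ hx =>
    obtain ⟨a, ha, x, hx, rfl⟩ := hx
    exact ⟨c * a, mul_nonneg c.2 ha, x, hx, (smul_smul (c : ℝ) a x)⟩

/-- A cone point is a multiple of a polytope point, and the multiplier is half its coordinate sum.
-/
theorem mem_dilateLatticePoints_iff [Fintype V] {G : SimpleGraph V} (hne : (edgePolytope G).Nonempty)
    (m : ℕ) (z : V → ℤ) :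
    z ∈ dilateLatticePoints G m ↔
      (fun v => (z v : ℝ)) ∈ edgeCone (⊤ : G.Subgraph) ∧ ∑ v, z v = 2 * (m : ℤ) := by
  constructor
  · rintro ⟨x, hx, hz⟩
    obtain ⟨hx1, hx2⟩ := edgePolytope_subset G hx
    refine ⟨?_, ?_⟩
    · have : (fun v => (z v : ℝ)) = (m : ℝ) • x := funext hz
      rw [this]
      exact smul_mem_edgeCone hx1 (Nat.cast_nonneg m)
    · have : (∑ v, (z v : ℝ)) = 2 * m := by
        simp only [hz]
        rw [← Finset.mul_sum, hx2, mul_comm]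
      exact_mod_cast this
  · rintro ⟨hz, hm⟩
    obtain ⟨c, hc, x, hx, hzx⟩ := exists_smul_of_mem_edgeCone_top hne hz
    have hcm : c = m := by
      have h1 : (∑ v, (z v : ℝ)) = 2 * m := by exact_mod_cast hm
      have h2 : (∑ v, (z v : ℝ)) = c * 2 := by
        rw [← (edgePolytope_subset G hx).2, Finset.mul_sum]
        exact Finset.sum_congr rfl fun v _ => congrFun hzx v
      linarith
    exact ⟨x, hx, fun v => by rw [← hcm]; exact congrFun hzx v⟩

theorem ehrhartSeries_eq_degreeSeries [Fintype V] {G : SimpleGraph V} (hne : (edgePolytope G).Nonempty) :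
    ehrhartSeries G = degreeSeries (LatticeCone.deg (H := (⊤ : G.Subgraph))) := by
  ext m
  simp only [ehrhartSeries, degreeSeries, PowerSeries.coeff_mk]
  have hcount : ehrhartCount G m = (dilateLatticePoints G m).ncard := by
    unfold ehrhartCount
    -- The conventional value at 0 agrees with the count: the zeroth dilate of a nonempty polytope
    -- is the origin.
    split_ifs with h
    · subst h
      symm
      rw [Set.ncard_eq_one]
      refine ⟨0, Set.eq_singleton_iff_unique_mem.2
        ⟨⟨_, hne.some_mem, fun v => by simp⟩, ?_⟩⟩
      rintro z ⟨x, -, hz⟩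
      funext v
      simpa using hz v
    · rfl
  rw [hcount, ← Nat.card_coe_set_eq]
  congr 1
  refine Nat.card_congr
    { toFun := fun z => ⟨⟨(z.1, m), (mem_dilateLatticePoints_iff hne m z.1).1 z.2⟩, rfl⟩
      invFun := fun q => ⟨q.1.1.1, ?_⟩
      left_inv := fun z => rfl
      right_inv := ?_ }
  · obtain ⟨⟨⟨z, k⟩, hq⟩, rfl⟩ := q
    exact (mem_dilateLatticePoints_iff hne _ z).2 hq
  · rintro ⟨⟨⟨z, k⟩, hq⟩, rfl⟩
    rfl

theorem LatticeCone.finite_deg_eq [Fintype V] (H : G.Subgraph) (m : ℕ) :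
    Finite {q : LatticeCone H // q.deg = m} := by
  have hfin := (Set.finite_Icc (0 : V → ℤ) fun _ => 2 * (m : ℤ)).to_subtype
  have hmem : ∀ q : {q : LatticeCone H // q.deg = m},
      q.1.1.1 ∈ Set.Icc (0 : V → ℤ) fun _ => 2 * (m : ℤ) := by
    rintro ⟨⟨⟨z, k⟩, hz, hk⟩, rfl⟩
    have h0 : ∀ v, 0 ≤ z v := fun v => by exact_mod_cast edgeCone_nonneg hz v
    refine ⟨h0, fun v => ?_⟩
    change z v ≤ 2 * (k : ℤ)
    rw [← hk]
    exact Finset.single_le_sum (fun v _ => h0 v) (Finset.mem_univ v)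
  refine Finite.of_injective
    (fun q => (⟨q.1.1.1, hmem q⟩ : Set.Icc (0 : V → ℤ) fun _ => 2 * (m : ℤ))) ?_
  rintro ⟨⟨⟨z, k⟩, hz⟩, rfl⟩ ⟨⟨⟨z', k'⟩, hz'⟩, hk⟩ h
  have h1 : z = z' := congrArg Subtype.val h
  have h2 : k' = k := hk
  subst h1 h2
  rfl

theorem degreeSeries_latticeCone_subgraphOfAdj [Fintype V] {u v : V} (huv : G.Adj u v) :
    degreeSeries (LatticeCone.deg (H := G.subgraphOfAdj huv)) * (1 - PowerSeries.X) = 1 := by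
  suffices h : degreeSeries (LatticeCone.deg (H := G.subgraphOfAdj huv)) =
      degreeSeries (fun x : ℕ => x) by rw [h, degreeSeries_id]
  have hvec : edgeVectors (G.subgraphOfAdj huv) = {Pi.single u 1 + Pi.single v 1} := by
    ext x
    simp only [edgeVectors, SimpleGraph.subgraphOfAdj_adj, Set.mem_ofPred_eq,
      Set.mem_singleton_iff]
    constructor
    · rintro ⟨a, b, hab, rfl⟩
      rcases Sym2.eq_iff.1 hab with ⟨rfl, rfl⟩ | ⟨rfl, rfl⟩
      · rfl
      · exact add_comm _ _
    · rintro rfl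
      exact ⟨u, v, rfl, rfl⟩
  have hsum : ∀ c : ℝ, ∑ w, (c • (Pi.single u 1 + Pi.single v 1 : V → ℝ)) w = c * 2 := by
    intro c
    simp only [Pi.smul_apply, smul_eq_mul, ← Finset.mul_sum, Pi.add_apply,
      Finset.sum_add_distrib, Finset.sum_pi_single', Finset.mem_univ, if_true]
    norm_num
  refine degreeSeries_eq_of_bijective (LatticeCone.deg (H := G.subgraphOfAdj huv)) ⟨?_, ?_⟩
    fun _ => rfl
  · have key : ∀ q : LatticeCone (G.subgraphOfAdj huv), (fun w => (q.1.1 w : ℝ)) =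
        (q.deg : ℝ) • (Pi.single u 1 + Pi.single v 1 : V → ℝ) := by
      rintro ⟨⟨z, m⟩, hz, hm⟩
      rw [edgeCone, hvec, Submodule.mem_span_singleton] at hz
      obtain ⟨c, hc⟩ := hz
      have h1 : (∑ v, (z v : ℝ)) = 2 * m := by exact_mod_cast hm
      have h2 : (∑ v, (z v : ℝ)) = c * 2 := by
        rw [← hsum]
        exact Finset.sum_congr rfl fun v _ => (congrFun hc v).symm
      have h3 : (c : ℝ) = m := by linarith
      change (fun w => (z w : ℝ)) = (m : ℝ) • _
      rw [← h3]
      exact hc.symm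
    intro q q' h
    refine Subtype.ext (Prod.ext (funext fun w => ?_) h)
    have h1 := congrFun (key q) w
    rw [h, ← key q'] at h1
    exact Int.cast_injective h1
  · intro m
    refine ⟨⟨(fun w => m * ((Pi.single u 1 + Pi.single v 1 : V → ℤ) w), m), ?_, ?_⟩, rfl⟩
    · rw [edgeCone, hvec, Submodule.mem_span_singleton]
      refine ⟨m, funext fun w => ?_⟩
      simp [NNReal.smul_def, Pi.single_apply, mul_add]
    · simp only [← Finset.mul_sum, Pi.add_apply, Finset.sum_add_distrib, Finset.sum_pi_single',
        Finset.mem_univ, if_true]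
      ring

end

/-! ### Cyclic order on a polygon. -/

theorem SimpleGraph.cycleGraph_adj_iff_succ {N : ℕ} (hN : 1 ≤ N) (i j : Fin (N + 1)) :
    (SimpleGraph.cycleGraph (N + 1)).Adj i j ↔ i = j + 1 ∨ j = i + 1 := by
  obtain ⟨N, rfl⟩ := Nat.exists_eq_add_of_le' hN
  rw [SimpleGraph.cycleGraph_adj, sub_eq_iff_eq_add', sub_eq_iff_eq_add']

theorem Fin.eq_add_one_iff {N : ℕ} (i j : Fin (N + 1)) :
    i = j + 1 ↔ (∃ l : Fin N, j = l.castSucc ∧ i = l.succ) ∨ (j = Fin.last N ∧ i = 0) := by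
  induction j using Fin.lastCases with
  | last =>
    simp only [Fin.last_add_one, true_and]
    refine ⟨Or.inr, ?_⟩
    rintro (⟨l, hl, -⟩ | h)
    · exact absurd hl.symm (Fin.castSucc_lt_last l).ne
    · exact h
  | cast l =>
    rw [Fin.coeSucc_eq_succ]
    refine ⟨fun h => Or.inl ⟨l, rfl, h⟩, ?_⟩
    rintro (⟨l', hl, rfl⟩ | ⟨hl, -⟩)
    · rw [Fin.castSucc_injective _ hl]
    · exact absurd hl (Fin.castSucc_lt_last l).ne

/-- The vertices of a polygon in cyclic order, starting and ending at the ends of a given edge. -/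
theorem IsPolygon.exists_cyclic_order {V : Type*} {G : SimpleGraph V} {C : G.Subgraph} {N : ℕ}
    (hC : IsPolygon C (N + 1)) {u v : V} (huv : C.Adj u v) :
    ∃ φ : Fin (N + 1) → V, Function.Injective φ ∧ Set.range φ = C.verts ∧
      s(φ 0, φ (Fin.last N)) = s(u, v) ∧
      ∀ a b, C.Adj a b ↔
        (∃ l : Fin N, s(a, b) = s(φ l.castSucc, φ l.succ)) ∨ s(a, b) = s(u, v) := by
  obtain ⟨hN, ⟨e⟩⟩ := hC
  have hN1 : 1 ≤ N := by omega
  -- The ends of the edge enter symmetrically, so `v` may be taken as the successor of `u`.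
  wlog h : e ⟨v, huv.snd_mem⟩ = e ⟨u, huv.fst_mem⟩ + 1 generalizing u v with H
  · have hadj : (SimpleGraph.cycleGraph (N + 1)).Adj (e ⟨u, huv.fst_mem⟩)
        (e ⟨v, huv.snd_mem⟩) := e.map_adj_iff.2 huv
    rw [SimpleGraph.cycleGraph_adj_iff_succ hN1] at hadj
    have h' := H huv.symm (hadj.resolve_right h)
    rwa [Sym2.eq_swap (a := v)] at h'
  set x := e ⟨v, huv.snd_mem⟩
  -- A rotation putting `v` at position 0, hence its predecessor `u` at the last position.
  let ψ : Fin (N + 1) ≃ C.verts := (Equiv.addRight x).trans e.toEquiv.symm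
  have hψ : ∀ i, e (ψ i) = i + x := fun i => e.apply_symm_apply _
  have hadj : ∀ i j, C.Adj (ψ i) (ψ j) ↔ i = j + 1 ∨ j = i + 1 := by
    intro i j
    have h1 : C.Adj (ψ i) (ψ j) ↔ (SimpleGraph.cycleGraph (N + 1)).Adj (e (ψ i)) (e (ψ j)) :=
      e.map_adj_iff.symm
    rw [h1, SimpleGraph.cycleGraph_adj_iff_succ hN1, hψ, hψ, add_right_comm j, add_right_comm i,
      add_left_inj, add_left_inj]
  have h0 : (ψ 0 : V) = v := by
    have : ψ 0 = ⟨v, huv.snd_mem⟩ := e.injective (by rw [hψ, zero_add])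
    rw [this]
  have hl : (ψ (Fin.last N) : V) = u := by
    have : ψ (Fin.last N) = ⟨u, huv.fst_mem⟩ := e.injective (by
      rw [hψ, h, add_comm _ (1 : Fin (N + 1)), ← add_assoc, Fin.last_add_one, zero_add])
    rw [this]
  refine ⟨fun i => ψ i, Subtype.val_injective.comp ψ.injective, ?_, ?_, ?_⟩
  · ext w
    constructor
    · rintro ⟨i, rfl⟩
      exact (ψ i).2
    · intro hw
      exact ⟨ψ.symm ⟨w, hw⟩, by simp⟩
  · change s((ψ 0 : V), (ψ (Fin.last N) : V)) = s(u, v)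
    rw [h0, hl, Sym2.eq_swap]
  · intro a b
    constructor
    · intro hab
      obtain ⟨i, hi⟩ := ψ.surjective ⟨a, hab.fst_mem⟩
      obtain ⟨j, hj⟩ := ψ.surjective ⟨b, hab.snd_mem⟩
      have hi' : a = ψ i := by rw [hi]
      have hj' : b = ψ j := by rw [hj]
      subst hi' hj'
      rw [hadj, Fin.eq_add_one_iff, Fin.eq_add_one_iff] at hab
      rcases hab with (⟨l, rfl, rfl⟩ | ⟨rfl, rfl⟩) | (⟨l, rfl, rfl⟩ | ⟨rfl, rfl⟩)
      · exact Or.inl ⟨l, Sym2.eq_swap⟩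
      · right
        rw [h0, hl, Sym2.eq_swap]
      · exact Or.inl ⟨l, rfl⟩
      · right
        rw [h0, hl]
    · rintro (⟨l, hab⟩ | hab)
      · have h1 : C.Adj (ψ l.castSucc) (ψ l.succ) :=
          (hadj _ _).2 (Or.inr ((Fin.eq_add_one_iff _ _).2 (Or.inl ⟨l, rfl, rfl⟩)))
        rw [← SimpleGraph.Subgraph.mem_edgeSet] at h1 ⊢
        rwa [hab]
      · rw [← SimpleGraph.Subgraph.mem_edgeSet, hab]
        exact huv

/-! ### Path weightings and ears. -/

/-- The degrees of an edge weighting `p` of the path with vertices `φ 0, …, φ N`. -/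
def pathDegree {V R : Type*} [DecidableEq V] [Semiring R] {N : ℕ} (φ : Fin (N + 1) → V)
    (p : Fin N → R) (w : V) : R :=
  ∑ l, p l * ((Pi.single (φ l.castSucc) 1 + Pi.single (φ l.succ) 1 : V → R) w)

section

variable {V R : Type*} [DecidableEq V] {N : ℕ} {φ : Fin (N + 1) → V}

theorem pathDegree_apply_succ [Semiring R] (hφ : Function.Injective φ) (p : Fin N → R)
    {i j : Fin N} (hij : i.val + 1 = j.val) : pathDegree φ p (φ i.succ) = p i + p j := by
  have h : i.succ = j.castSucc := Fin.ext hij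
  simp only [pathDegree, Pi.add_apply, Pi.single_apply, mul_add, mul_ite, mul_one, mul_zero,
    Finset.sum_add_distrib, hφ.eq_iff, Fin.succ_inj]
  simp only [h, Fin.castSucc_inj, Finset.sum_ite_eq, Finset.mem_univ, if_true]
  exact add_comm _ _

theorem sum_pathDegree [CommSemiring R] [Fintype V] (φ : Fin (N + 1) → V) (p : Fin N → R) :
    ∑ w, pathDegree φ p w = 2 * ∑ l, p l := by
  simp only [pathDegree]
  rw [Finset.sum_comm, Finset.mul_sum]
  refine Finset.sum_congr rfl fun l _ => ?_
  rw [← Finset.mul_sum]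
  simp only [Pi.add_apply, Finset.sum_add_distrib, Finset.sum_pi_single', Finset.mem_univ,
    if_true]
  ring

theorem Fin.sum_neg_one_pow_mul_add [CommRing R] (N : ℕ) (h : Fin (N + 1) → R) :
    ∑ l : Fin N, (-1) ^ l.val * (h l.castSucc + h l.succ) =
      h 0 - (-1) ^ N * h (Fin.last N) := by
  induction N with
  | zero => simp
  | succ N ih =>
    have := ih fun i => h i.castSucc
    simp only [← Fin.succ_castSucc, Fin.castSucc_zero] at this
    rw [Fin.sum_univ_castSucc]
    simp only [Fin.val_castSucc, Fin.val_last, this, Fin.succ_last]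
    ring

/-- The alternating sum of the edge vectors telescopes, and for odd `N` the two end vectors survive
with equal sign. This is where even cycle length enters. -/
theorem pathDegree_sub_alternating [CommRing R] (hN : Odd N) (φ : Fin (N + 1) → V)
    (p : Fin N → R) (c : R) (w : V) :
    pathDegree φ p w = c * (Pi.single (φ 0) 1 + Pi.single (φ (Fin.last N)) 1 : V → R) w +
      pathDegree φ (fun l => p l - c * (-1) ^ l.val) w := by
  have h := Fin.sum_neg_one_pow_mul_add N fun i => (Pi.single (φ i) 1 : V → R) w
  rw [hN.neg_one_pow] at h
  simp only [pathDegree, Pi.add_apply, sub_mul, Finset.sum_sub_distrib, mul_assoc,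
    ← Finset.mul_sum, h]
  ring

theorem pathDegree_natCast_apply [Ring R] (φ : Fin (N + 1) → V) (p : Fin N → ℕ) (w : V) :
    ((pathDegree φ (fun l => (p l : ℤ)) w : ℤ) : R) = pathDegree φ (fun l => (p l : R)) w := by
  simp [pathDegree, Pi.single_apply]

/-- The subgraph `K` arises from `H` by adding the path with vertices `φ 0, …, φ N`, whose ends
are adjacent in `H` and whose inner vertices are new. -/
structure IsEar {G : SimpleGraph V} (H K : G.Subgraph) (φ : Fin (N + 1) → V) : Prop where
  injective : Function.Injective φ
  adj : H.Adj (φ 0) (φ (Fin.last N))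
  notMem : ∀ i : Fin (N + 1), i ≠ 0 → i ≠ Fin.last N → φ i ∉ H.verts
  adj_iff : ∀ a b, K.Adj a b ↔
    H.Adj a b ∨ ∃ l : Fin N, s(a, b) = s(φ l.castSucc, φ l.succ)

variable {G : SimpleGraph V} {H K : G.Subgraph}

theorem IsEar.edgeVectors_eq (h : IsEar H K φ) :
    edgeVectors K = edgeVectors H ∪
      Set.range fun l : Fin N => (Pi.single (φ l.castSucc) 1 + Pi.single (φ l.succ) 1) := by
  ext x
  constructor
  · rintro ⟨a, b, hab, rfl⟩
    rcases (h.adj_iff a b).1 hab with hab | ⟨l, hl⟩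
    · exact Or.inl ⟨a, b, hab, rfl⟩
    · rcases Sym2.eq_iff.1 hl with ⟨rfl, rfl⟩ | ⟨rfl, rfl⟩
      · exact Or.inr ⟨l, rfl⟩
      · exact Or.inr ⟨l, add_comm _ _⟩
  · rintro (⟨a, b, hab, rfl⟩ | ⟨l, rfl⟩)
    · exact ⟨a, b, (h.adj_iff a b).2 (Or.inl hab), rfl⟩
    · exact ⟨_, _, (h.adj_iff _ _).2 (Or.inr ⟨l, rfl⟩), rfl⟩

theorem IsEar.mem_edgeCone_iff (h : IsEar H K φ) (x : V → ℝ) :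
    x ∈ edgeCone K ↔ ∃ a ∈ edgeCone H, ∃ p : Fin N → ℝ, (∀ l, 0 ≤ p l) ∧
      ∀ w, x w = a w + pathDegree φ p w := by
  rw [edgeCone, h.edgeVectors_eq, Submodule.span_union, Submodule.mem_sup]
  refine exists_congr fun a => and_congr_right fun _ => ?_
  constructor
  · rintro ⟨y, hy, rfl⟩
    obtain ⟨c, rfl⟩ := (Submodule.mem_span_range_iff_exists_fun _).1 hy
    refine ⟨fun l => c l, fun l => (c l).2, fun w => ?_⟩
    simp [pathDegree, NNReal.smul_def, mul_add]
  · rintro ⟨p, hp, hx⟩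
    refine ⟨pathDegree φ p, (Submodule.mem_span_range_iff_exists_fun _).2
      ⟨fun l => ⟨p l, hp l⟩, ?_⟩, funext fun w => (hx w).symm⟩
    funext w
    rw [Finset.sum_apply]
    rfl

/-- At an inner vertex only the two path edges meeting there contribute, so a point of the new cone
determines the sums of consecutive path weights. -/
theorem IsEar.apply_succ (h : IsEar H K φ) {a : V → ℝ} (ha : a ∈ edgeCone H) {i j : Fin N}
    (hij : i.val + 1 = j.val) : a (φ i.succ) = 0 := by
  refine edgeCone_eq_zero ha (h.notMem _ (Fin.succ_ne_zero i) fun hl => ?_)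
  have := congrArg Fin.val hl
  simp only [Fin.val_succ, Fin.val_last] at this
  omega

end

/-- Propagation along the path, for integrality of weights and for the difference of two weightings.
-/
theorem Fin.forall_iff_of_consecutive {N : ℕ} {P : Fin N → Prop}
    (h : ∀ i j : Fin N, i.val + 1 = j.val → (P i ↔ P j)) (i j : Fin N) : P i ↔ P j := by
  have hz : ∀ k (hk : k < N), P ⟨k, hk⟩ ↔ P ⟨0, by omega⟩ := by
    intro k
    induction k with
    | zero => exact fun _ => Iff.rfl
    | succ k ih => exact fun hk => (h ⟨k, by omega⟩ ⟨k + 1, hk⟩ rfl).symm.trans (ih _)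
  exact (hz i.1 i.2).trans (hz j.1 j.2).symm

/-! ### Unique decomposition of lattice points along an ear. -/

section

variable {V : Type*} [DecidableEq V] {G : SimpleGraph V} {H K : G.Subgraph} {r : ℕ}
  {φ : Fin (2 * r + 1 + 1) → V}

/-- Every integral point of the cone of `K` is the sum of an integral point of the cone of `H`
and the degree vector of a reduced integral weighting of the added path. -/
theorem IsEar.exists_decomposition (h : IsEar H K φ) {z : V → ℤ}
    (hz : (fun v => (z v : ℝ)) ∈ edgeCone K) :
    ∃ p : ReducedPath r,
      (fun v => ((z v - pathDegree φ (fun l => (p.1 l : ℤ)) v : ℤ) : ℝ)) ∈ edgeCone H := by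
  obtain ⟨a, ha, p, hp, hzp⟩ := (h.mem_edgeCone_iff _).1 hz
  obtain ⟨i, hi, hmin⟩ := Finset.exists_min_image
    (Finset.univ.filter fun i : Fin (2 * r + 1) => Even i.val) p ⟨0, by simp⟩
  simp only [Finset.mem_filter, Finset.mem_univ, true_and] at hi hmin
  -- Even-indexed weights drop by their minimum `p i` and odd-indexed ones rise by it, so `q` stays
  -- nonnegative.
  set q : Fin (2 * r + 1) → ℝ := fun l => p l - p i * (-1) ^ l.val with hq
  have hq0 : ∀ l, 0 ≤ q l := by
    intro l
    rcases Nat.even_or_odd l.val with hl | hl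
    · simpa [hq, hl.neg_one_pow] using hmin l hl
    · simpa [hq, hl.neg_one_pow] using add_nonneg (hp l) (hp i)
  have hqi : q i = 0 := by simp [hq, hi.neg_one_pow]
  set b : V → ℝ := a + p i • (Pi.single (φ 0) 1 + Pi.single (φ (Fin.last _)) 1)
  have hbH : b ∈ edgeCone H :=
    add_mem ha (smul_mem_edgeCone (Submodule.subset_span ⟨_, _, h.adj, rfl⟩) (hp i))
  have hzq : ∀ w, (z w : ℝ) = b w + pathDegree φ q w := by
    intro w
    rw [hzp, pathDegree_sub_alternating (odd_two_mul_add_one r) φ p (p i) w, ← add_assoc]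
    rfl
  -- Consecutive weights sum to an integer coordinate of `z`, so integrality spreads from `q i = 0`.
  have hint : ∀ l, ∃ k : ℤ, q l = k := by
    intro l
    refine (Fin.forall_iff_of_consecutive (P := fun l => ∃ k : ℤ, q l = k) ?_ i l).1
      ⟨0, by simp [hqi]⟩
    intro s t hst
    have hs := hzq (φ s.succ)
    rw [h.apply_succ hbH hst, pathDegree_apply_succ h.injective q hst, zero_add] at hs
    constructor
    · rintro ⟨k, hk⟩
      exact ⟨z (φ s.succ) - k, by push_cast; linarith⟩
    · rintro ⟨k, hk⟩
      exact ⟨z (φ s.succ) - k, by push_cast; linarith⟩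
  have hnat : ∀ l, ∃ k : ℕ, q l = k := by
    intro l
    obtain ⟨k, hk⟩ := hint l
    have hk0 : 0 ≤ k := by
      have := hq0 l
      rw [hk] at this
      exact_mod_cast this
    lift k to ℕ using hk0
    exact ⟨k, by simpa using hk⟩
  choose n hn using hnat
  refine ⟨⟨n, i, hi, ?_⟩, ?_⟩
  · have := hn i
    rw [hqi] at this
    exact_mod_cast this.symm
  · convert hbH using 1
    funext w
    have hqn : q = fun l => (n l : ℝ) := funext hn
    rw [Int.cast_sub, hzq w, pathDegree_natCast_apply, sub_eq_iff_eq_add]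
    exact congrArg (fun t => b w + pathDegree φ t w) hqn

theorem IsEar.decomposition_unique (h : IsEar H K φ) {z z' : V → ℤ}
    (hz : (fun v => (z v : ℝ)) ∈ edgeCone H) (hz' : (fun v => (z' v : ℝ)) ∈ edgeCone H)
    {p p' : ReducedPath r}
    (heq : ∀ v, z v + pathDegree φ (fun l => (p.1 l : ℤ)) v =
      z' v + pathDegree φ (fun l => (p'.1 l : ℤ)) v) : p = p' := by
  have hstep : ∀ i j : Fin (2 * r + 1), i.val + 1 = j.val →
      (p.1 i : ℤ) + p.1 j = p'.1 i + p'.1 j := by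
    intro i j hij
    have h1 := heq (φ i.succ)
    have h2 : (z (φ i.succ) : ℝ) = 0 := h.apply_succ hz hij
    have h3 : (z' (φ i.succ) : ℝ) = 0 := h.apply_succ hz' hij
    rw [pathDegree_apply_succ h.injective _ hij, pathDegree_apply_succ h.injective _ hij,
      Int.cast_eq_zero.1 h2, Int.cast_eq_zero.1 h3] at h1
    simpa using h1
  obtain ⟨p, s, hs, hps⟩ := p
  obtain ⟨p', t, ht, hpt⟩ := p'
  dsimp only at hstep
  have hconst : ∀ l : Fin (2 * r + 1), (p l : ℤ) - p' l = (-1) ^ l.val * ((p s : ℤ) - p' s) := by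
    intro l
    refine (Fin.forall_iff_of_consecutive
      (P := fun l => (p l : ℤ) - p' l = (-1) ^ l.val * ((p s : ℤ) - p' s)) ?_ s l).1
      (by rw [hs.neg_one_pow, one_mul])
    intro i j hij
    have := hstep i j hij
    rw [← hij, pow_succ, mul_neg_one, neg_mul]
    constructor <;> intro _ <;> linarith
  -- The signs at `s` and `t` are both positive, so `p t - 0 = 0 - p' s` with both weights
  -- nonnegative: the difference vanishes.
  have hts := hconst t
  rw [ht.neg_one_pow, one_mul] at hts
  have h0 : (p s : ℤ) - p' s = 0 := by omega
  refine Subtype.ext (funext fun l => ?_)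
  have := hconst l
  rw [h0, mul_zero] at this
  change p l = p' l
  omega

theorem IsEar.degreeSeries_eq [Fintype V] (h : IsEar H K φ) :
    degreeSeries (LatticeCone.deg (H := K)) =
      degreeSeries (LatticeCone.deg (H := H)) * degreeSeries (ReducedPath.deg (r := r)) := by
  rw [← degreeSeries_prod (LatticeCone.finite_deg_eq H) (ReducedPath.finite_deg_eq r)]
  symm
  let g : LatticeCone H × ReducedPath r → LatticeCone K := fun x =>
    ⟨(fun v => x.1.1.1 v + pathDegree φ (fun l => (x.2.1 l : ℤ)) v, x.1.deg + x.2.deg), by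
      refine ⟨(h.mem_edgeCone_iff _).2 ⟨_, x.1.2.1, fun l => (x.2.1 l : ℝ),
        fun l => Nat.cast_nonneg _, fun w => ?_⟩, ?_⟩
      · rw [← pathDegree_natCast_apply]
        push_cast
        rfl
      · have h1 : ∑ v, x.1.1.1 v = 2 * (x.1.deg : ℤ) := x.1.2.2
        simp only [Finset.sum_add_distrib, sum_pathDegree, h1, ReducedPath.deg]
        push_cast
        ring⟩
  refine degreeSeries_eq_of_bijective g ⟨?_, ?_⟩ fun x => rfl
  · rintro ⟨⟨⟨z, m⟩, hz⟩, p⟩ ⟨⟨⟨z', m'⟩, hz'⟩, p'⟩ hg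
    have hval := congrArg (fun q : LatticeCone K => q.1) hg
    have hfst := congrFun (congrArg Prod.fst hval)
    have hsnd := congrArg Prod.snd hval
    dsimp only [g, LatticeCone.deg] at hfst hsnd
    obtain rfl : p = p' := h.decomposition_unique hz.1 hz'.1 hfst
    obtain rfl : m = m' := Nat.add_right_cancel hsnd
    obtain rfl : z = z' := funext fun v => add_right_cancel (hfst v)
    rfl
  · rintro ⟨⟨z, m⟩, hz, hm⟩
    obtain ⟨p, hp⟩ := h.exists_decomposition hz
    dsimp only at hm
    have hsum : ∑ v, (z v - pathDegree φ (fun l => (p.1 l : ℤ)) v) =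
        2 * ((m : ℤ) - p.deg) := by
      rw [Finset.sum_sub_distrib, sum_pathDegree, hm, ReducedPath.deg]
      push_cast
      ring
    -- This forces `p.deg ≤ m`, so the truncated subtraction `m - p.deg` is exact.
    have hnonneg : 0 ≤ ∑ v, (z v - pathDegree φ (fun l => (p.1 l : ℤ)) v) :=
      Finset.sum_nonneg fun v _ => by exact_mod_cast edgeCone_nonneg hp v
    have hle : p.deg ≤ m := by omega
    refine ⟨(⟨(_, m - p.deg), hp, ?_⟩, p), Subtype.ext (Prod.ext (funext fun v => ?_) ?_)⟩
    · dsimp only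
      rw [hsum, Nat.cast_sub hle]
    · exact sub_add_cancel _ _
    · exact Nat.sub_add_cancel hle

end

/-! ### Gluing polygons and induction over the construction. -/

/-- For `1 ≤ r` every path edge has an inner vertex as an end, so none lies in `H`; for `r = 0` the
path would be an edge of `H` itself. -/
theorem IsEar.ncard_edgeSet {V : Type*} [Finite V] {G : SimpleGraph V} {H K : G.Subgraph} {r : ℕ}
    {φ : Fin (2 * r + 1 + 1) → V} (h : IsEar H K φ) (hr : 1 ≤ r) :
    K.edgeSet.ncard = H.edgeSet.ncard + (2 * r + 1) := by
  set ε : Fin (2 * r + 1) → Sym2 V := fun l => s(φ l.castSucc, φ l.succ) with hε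
  have hinj : Function.Injective ε := by
    intro l l' hl
    rcases Sym2.eq_iff.1 hl with ⟨h1, -⟩ | ⟨h1, h2⟩
    · exact Fin.castSucc_injective _ (h.injective h1)
    · have h1 := congrArg Fin.val (h.injective h1)
      have h2 := congrArg Fin.val (h.injective h2)
      simp only [Fin.val_castSucc, Fin.val_succ] at h1 h2
      omega
  have hdisj : Disjoint H.edgeSet (Set.range ε) := by
    rw [Set.disjoint_right]
    rintro _ ⟨l, rfl⟩ hl
    have hl : H.Adj (φ l.castSucc) (φ l.succ) := hl
    by_cases h0 : l.val = 0
    · refine h.notMem l.succ (Fin.succ_ne_zero l) (fun hlast => ?_) hl.snd_mem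
      have := congrArg Fin.val hlast
      simp only [Fin.val_succ, Fin.val_last] at this
      omega
    · refine h.notMem l.castSucc (fun hz => h0 ?_) (Fin.castSucc_lt_last l).ne hl.fst_mem
      simpa using congrArg Fin.val hz
  have hunion : K.edgeSet = H.edgeSet ∪ Set.range ε := by
    ext e
    induction e with
    | _ a b =>
      rw [SimpleGraph.Subgraph.mem_edgeSet, h.adj_iff]
      simp only [Set.mem_union, SimpleGraph.Subgraph.mem_edgeSet, Set.mem_range, hε, eq_comm]
  rw [hunion, Set.ncard_union_eq hdisj (Set.toFinite _) (Set.toFinite _), ← Set.image_univ,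
    Set.ncard_image_of_injective _ hinj, Set.ncard_univ, Nat.card_fin]

/-- Removing the shared edge from the cycle leaves the ear. -/
theorem IsPolygon.exists_isEar {V : Type*} {G : SimpleGraph V}
    {H C : G.Subgraph} {N : ℕ} (hC : IsPolygon C (N + 1)) {u v : V} (huv : G.Adj u v)
    (hHC : H ⊓ C = G.subgraphOfAdj huv) : ∃ φ : Fin (N + 1) → V, IsEar H (H ⊔ C) φ := by
  have hinf : (H ⊓ C).Adj u v := hHC ▸ SimpleGraph.subgraphOfAdj_adj_self huv
  obtain ⟨φ, hφ, hrange, hends, hadj⟩ := hC.exists_cyclic_order hinf.2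
  refine ⟨φ, hφ, ?_, ?_, ?_⟩
  · rw [← SimpleGraph.Subgraph.mem_edgeSet, hends]
    exact hinf.1
  · intro i hi0 hil hiH
    have hmem : φ i ∈ (H ⊓ C).verts := ⟨hiH, hrange ▸ Set.mem_range_self i⟩
    rw [hHC] at hmem
    have hmem' : φ i ∈ s(u, v) := by
      rw [Sym2.mem_iff]
      exact hmem
    rw [← hends, Sym2.mem_iff, hφ.eq_iff, hφ.eq_iff] at hmem'
    exact hmem'.elim hi0 hil
  · intro a b
    rw [SimpleGraph.Subgraph.sup_adj, hadj]
    refine ⟨?_, ?_⟩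
    · rintro (h | h | h)
      · exact Or.inl h
      · exact Or.inr h
      · left
        rw [← SimpleGraph.Subgraph.mem_edgeSet, h]
        exact hinf.1
    · rintro (h | h)
      · exact Or.inl h
      · exact Or.inr (Or.inl h)

theorem IsPolygon.exists_adj {V : Type*} {G : SimpleGraph V} {C : G.Subgraph} {k : ℕ}
    (hC : IsPolygon C k) : ∃ u v, C.Adj u v := by
  obtain ⟨hk, ⟨e⟩⟩ := hC
  obtain ⟨N, rfl⟩ : ∃ N, k = N + 1 := ⟨k - 1, by omega⟩
  have h : (SimpleGraph.cycleGraph (N + 1)).Adj 0 (0 + 1) :=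
    (SimpleGraph.cycleGraph_adj_iff_succ (by omega) _ _).2 (Or.inr rfl)
  exact ⟨e.symm 0, e.symm (0 + 1), e.symm.map_adj_iff.2 h⟩

/-- The number of edges and the graded count of lattice points of a subgraph built from an edge
by attaching polygons whose lengths form the multiset `s`. -/
def HasPolygonSeries {V : Type*} [Fintype V] [DecidableEq V] {G : SimpleGraph V}
    (H : G.Subgraph) (s : Multiset ℕ) : Prop :=
  ∃ d : ℕ, H.edgeSet.ncard = s.card + d ∧
    degreeSeries (LatticeCone.deg (H := H)) * (1 - PowerSeries.X) ^ d =
      (s.map fun k => ∑ i ∈ Finset.range (k / 2), (PowerSeries.X : PowerSeries ℚ) ^ i).prod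

section

variable {V : Type*} [Fintype V] [DecidableEq V] {G : SimpleGraph V}

theorem hasPolygonSeries_subgraphOfAdj {u v : V} (huv : G.Adj u v) :
    HasPolygonSeries (G.subgraphOfAdj huv) 0 :=
  ⟨1, by simp, by rw [pow_one, degreeSeries_latticeCone_subgraphOfAdj]; simp⟩

theorem HasPolygonSeries.glue {H C : G.Subgraph} {s : Multiset ℕ} {k : ℕ} {u v : V}
    (hH : HasPolygonSeries H s) (hC : IsPolygon C k) (hk : Even k) (huv : G.Adj u v)
    (hHC : H ⊓ C = G.subgraphOfAdj huv) : HasPolygonSeries (H ⊔ C) (k ::ₘ s) := by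
  obtain ⟨d, hd, hs⟩ := hH
  obtain ⟨r, hr, rfl⟩ : ∃ r, 1 ≤ r ∧ k = 2 * r + 1 + 1 := by
    obtain ⟨n, rfl⟩ := hk
    have := hC.1
    exact ⟨n - 1, by omega, by omega⟩
  obtain ⟨φ, hφ⟩ := hC.exists_isEar huv hHC
  -- Of the `2 * r + 1` new edges, one is offset by the new polygon.
  refine ⟨d + 2 * r, ?_, ?_⟩
  · rw [hφ.ncard_edgeSet hr, hd, Multiset.card_cons]
    ring
  · rw [Multiset.map_cons, Multiset.prod_cons, ← hs, hφ.degreeSeries_eq,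
      show (2 * r + 1 + 1) / 2 = r + 1 by omega, ← degreeSeries_reducedPath]
    ring

theorem IsPolygonTree.hasPolygonSeries {H : G.Subgraph} {s : Multiset ℕ}
    (hH : IsPolygonTree H s) (hs : ∀ k ∈ s, Even k) : HasPolygonSeries H s := by
  induction hH with
  | @polygon C k hC =>
    -- The initial polygon counts as glued onto one of its own edges, so it needs no separate
    -- computation.
    obtain ⟨u, v, huv⟩ := hC.exists_adj
    have hle : G.subgraphOfAdj (C.adj_sub huv) ≤ C := SimpleGraph.subgraphOfAdj_le_of_adj C huv
    have h := (hasPolygonSeries_subgraphOfAdj (C.adj_sub huv)).glue hC (hs k (by simp)) _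
      (inf_eq_left.2 hle)
    rwa [sup_eq_right.2 hle] at h
  | glue _ hC huv hHC ih =>
    exact (ih fun k hk => hs k (Multiset.mem_cons_of_mem hk)).glue hC
      (hs _ (Multiset.mem_cons_self _ _)) huv hHC

end

theorem IsPolygonTree.edgePolytope_nonempty {V : Type*} [DecidableEq V] {G : SimpleGraph V}
    {s : Multiset ℕ}
    (hG : IsPolygonTree (⊤ : G.Subgraph) s) : (edgePolytope G).Nonempty := by
  have hadj : ∀ {H : G.Subgraph}, IsPolygonTree H s → ∃ u v, H.Adj u v := by
    intro H hH
    cases hH with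
    | polygon hC => exact hC.exists_adj
    | glue _ hC _ _ =>
      obtain ⟨u, v, huv⟩ := hC.exists_adj
      exact ⟨u, v, Or.inr huv⟩
  obtain ⟨u, v, huv⟩ := hadj hG
  exact ⟨_, subset_convexHull ℝ _ ⟨u, v, by simpa using huv, rfl⟩⟩

theorem proposition4p2 {V : Type*} [Fintype V] [DecidableEq V] (G : SimpleGraph V)
    (f : ℕ →₀ ℕ) (hG : IsBipartitePolygonTree G f) :
    ∑ n ∈ f.support, f n ≤ G.edgeSet.ncard ∧
      ehrhartSeries G =
        (∏ n ∈ f.support, (∑ i ∈ Finset.range n, (PowerSeries.X : PowerSeries ℚ) ^ i) ^ f n) *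
          ((1 - PowerSeries.X) ^ (G.edgeSet.ncard - ∑ n ∈ f.support, f n))⁻¹ := by
  obtain ⟨s, hs, heven, hf⟩ := hG
  obtain ⟨d, hd, hser⟩ := hs.hasPolygonSeries heven
  -- All lengths are even, so halving is injective on them and `f` is the multiplicity function of
  -- the half-lengths.
  obtain rfl : f = Multiset.toFinsupp (s.map (· / 2)) := by
    ext n
    rw [hf, Multiset.toFinsupp_apply, Multiset.count_map, ← Multiset.countP_eq_card_filter,
      Multiset.count]
    refine Multiset.countP_congr rfl fun k hk => ?_
    obtain ⟨j, rfl⟩ := heven k hk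
    simp only [eq_iff_iff]
    omega
  have hcard : ∑ n ∈ (Multiset.toFinsupp (s.map (· / 2))).support,
      Multiset.toFinsupp (s.map (· / 2)) n = s.card := by
    simp only [Multiset.toFinsupp_support, Multiset.toFinsupp_apply]
    rw [Multiset.toFinset_sum_count_eq, Multiset.card_map]
  have hprod : ∏ n ∈ (Multiset.toFinsupp (s.map (· / 2))).support,
      (∑ i ∈ Finset.range n, (PowerSeries.X : PowerSeries ℚ) ^ i) ^
        Multiset.toFinsupp (s.map (· / 2)) n =
      (s.map fun k => ∑ i ∈ Finset.range (k / 2), (PowerSeries.X : PowerSeries ℚ) ^ i).prod := by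
    simp only [Multiset.toFinsupp_support, Multiset.toFinsupp_apply]
    rw [← Finset.prod_multiset_map_count, Multiset.map_map]
    rfl
  rw [SimpleGraph.Subgraph.edgeSet_top] at hd
  rw [hcard, hprod, hd, Nat.add_sub_cancel_left]
  refine ⟨Nat.le_add_right _ _, ?_⟩
  rw [PowerSeries.eq_mul_inv_iff_mul_eq (by simp),
    ehrhartSeries_eq_degreeSeries hs.edgePolytope_nonempty, hser]
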